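/- Let $n\ge 1$ be an integer and let $K\subset\mathbb R^n$ be a convex body (a compact convex set with nonempty interior). Let $C(K)$ be the space of continuous functions $f:K\to\mathbb R$ with the uniform norm, and let $\Pi_1(\mathbb R^n)$ be the space of polynomials in $n$ variables of degree at most $1$. For a nondegenerate $n$-dimensional simplex $S$ with vertices $x^{(1)},\dots,x^{(n+1)}\in K$, let $P_S:C(K)\to\Pi_1(\mathbb R^n)$ be the interpolation projector with nodes $x^{(j)}$, i.e. $P_Sf$ is the unique element of $\Pi_1(\mathbb R^n)$ with $P_Sf(x^{(j)})=f(x^{(j)})$ for $1\le j\le n+1$, and let $\|P_S\|_K$ be its norm as an operator from $C(K)$ into $C(K)$. Let $\theta_n(K)$ be the minimal value of $\|P_S\|_K$ over all nondegenerate simplices $S$ with vertices in $K$. Theorem. For every integer $n\ge 1$, the minimum defining $\theta_n(Q_n)$ for the cube $Q_n=[0,1]^n$ is attained, and $$\theta_n(Q_n)>\frac{\sqrt{n-1}}{e}.$$ Consequently, for every integer $n\ge 1$, $$\theta_n(Q_n)>\frac{2\sqrt2}{3e}\,\sqrt n .$$ -/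

import Mathlib

/-!
Points of `ℝⁿ` are functions `Fin n → ℝ`; only the affine structure and the topology of `ℝⁿ`
are used. The space `C(K)` is `C(K, ℝ)` with the uniform norm, and the space `Π₁(ℝⁿ)` of
polynomials of degree at most `1` is the space of affine functions `(Fin n → ℝ) →ᵃ[ℝ] ℝ`.
-/

namespace LagrangeProjector

/-- The unit cube `Qₙ = [0,1]ⁿ`. -/
abbrev unitCube (n : ℕ) : Set (Fin n → ℝ) := Set.Icc 0 1

/-- The affine basis of `ℝⁿ` formed by the vertices of a nondegenerate `n`-dimensional simplex. -/
noncomputable def vertexBasis {n : ℕ} (S : Affine.Simplex ℝ (Fin n → ℝ) n) :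
    AffineBasis (Fin (n + 1)) ℝ (Fin n → ℝ) :=
  ⟨S.points, S.independent, by
    rw [S.independent.affineSpan_eq_top_iff_card_eq_finrank_add_one]
    simp⟩

/-- The basic Lagrange polynomial `λⱼ` of `S`: the `j`th barycentric coordinate. -/
noncomputable def lagrangePoly {n : ℕ} (S : Affine.Simplex ℝ (Fin n → ℝ) n) (j : Fin (n + 1)) :
    (Fin n → ℝ) →ᵃ[ℝ] ℝ :=
  (vertexBasis S).coord j

theorem lagrangePoly_points {n : ℕ} (S : Affine.Simplex ℝ (Fin n → ℝ) n) (j k : Fin (n + 1)) :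
    lagrangePoly S j (S.points k) = if j = k then 1 else 0 :=
  (vertexBasis S).coord_apply j k

/-- The interpolation projector `P_S : C(K) → Π₁(ℝⁿ)` with nodes the vertices of `S`. -/
noncomputable def interp {n : ℕ} {K : Set (Fin n → ℝ)} (S : Affine.Simplex ℝ (Fin n → ℝ) n)
    (hS : ∀ j, S.points j ∈ K) : C(K, ℝ) →ₗ[ℝ] ((Fin n → ℝ) →ᵃ[ℝ] ℝ) where
  toFun f := ∑ j, f ⟨S.points j, hS j⟩ • lagrangePoly S j
  map_add' f g := by simp [add_smul, Finset.sum_add_distrib]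
  map_smul' c f := by simp [Finset.smul_sum, mul_smul]

theorem interp_apply {n : ℕ} {K : Set (Fin n → ℝ)} (S : Affine.Simplex ℝ (Fin n → ℝ) n)
    (hS : ∀ j, S.points j ∈ K) (f : C(K, ℝ)) (x : Fin n → ℝ) :
    interp S hS f x = ∑ j, f ⟨S.points j, hS j⟩ * lagrangePoly S j x := by
  have h : ∀ (s : Finset (Fin (n + 1))) (g : Fin (n + 1) → ((Fin n → ℝ) →ᵃ[ℝ] ℝ)),
      (∑ j ∈ s, g j) x = ∑ j ∈ s, g j x := by
    intro s g
    induction s using Finset.induction_on with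
    | empty => simp
    | insert a s ha ih => simp [Finset.sum_insert ha, ih]
  simp [interp, h]

/-- `P_S f` is the affine function that agrees with `f` at the nodes. -/
theorem eq_interp_iff {n : ℕ} {K : Set (Fin n → ℝ)} (S : Affine.Simplex ℝ (Fin n → ℝ) n)
    (hS : ∀ j, S.points j ∈ K) (f : C(K, ℝ)) (p : (Fin n → ℝ) →ᵃ[ℝ] ℝ) :
    p = interp S hS f ↔ ∀ j, p (S.points j) = f ⟨S.points j, hS j⟩ := by
  have key : ∀ k, interp S hS f (S.points k) = f ⟨S.points k, hS k⟩ := by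
    intro k
    simp [interp_apply, lagrangePoly_points]
  constructor
  · rintro rfl
    exact key
  · intro h
    refine AffineMap.ext_on (s := Set.range S.points) (vertexBasis S).tot ?_
    rintro _ ⟨j, rfl⟩
    rw [h, key]

/-- Restriction of an affine function to `K`, as an element of `C(K)`. -/
noncomputable def restrictAffine {n : ℕ} (K : Set (Fin n → ℝ)) :
    ((Fin n → ℝ) →ᵃ[ℝ] ℝ) →ₗ[ℝ] C(K, ℝ) where
  toFun p := ⟨fun x => p x, p.continuous_of_finiteDimensional.comp continuous_subtype_val⟩
  map_add' p q := by ext x; simp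
  map_smul' c p := by ext x; simp

/-- The projector `P_S`, viewed as a bounded operator from `C(K)` into `C(K)`. -/
noncomputable def projector {n : ℕ} {K : Set (Fin n → ℝ)} [CompactSpace K]
    (S : Affine.Simplex ℝ (Fin n → ℝ) n) (hS : ∀ j, S.points j ∈ K) : C(K, ℝ) →L[ℝ] C(K, ℝ) :=
  (restrictAffine K ∘ₗ interp S hS).mkContinuous
    (∑ j, ‖restrictAffine K (lagrangePoly S j)‖) (by
      intro f
      have h : (restrictAffine K ∘ₗ interp S hS) f
          = ∑ j, f ⟨S.points j, hS j⟩ • restrictAffine K (lagrangePoly S j) := by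
        simp [interp, map_sum]
      rw [h, Finset.sum_mul]
      refine norm_sum_le_of_le _ fun j _ => ?_
      rw [norm_smul, mul_comm]
      gcongr
      exact f.norm_coe_le_norm _)

theorem projector_apply {n : ℕ} {K : Set (Fin n → ℝ)} [CompactSpace K]
    (S : Affine.Simplex ℝ (Fin n → ℝ) n) (hS : ∀ j, S.points j ∈ K) (f : C(K, ℝ)) (x : K) :
    projector S hS f x = interp S hS f x := rfl

/-- The set of the norms `‖P_S‖_K`, where `S` runs over all nondegenerate simplices with
vertices in `K`. -/
def projectorNorms {n : ℕ} (K : Set (Fin n → ℝ)) [CompactSpace K] : Set ℝ :=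
  {c | ∃ (S : Affine.Simplex ℝ (Fin n → ℝ) n) (hS : ∀ j, S.points j ∈ K), c = ‖projector S hS‖}

/-- `θₙ(K)`, the minimal value of `‖P_S‖_K`. -/
noncomputable def theta {n : ℕ} (K : Set (Fin n → ℝ)) [CompactSpace K] : ℝ :=
  sInf (projectorNorms K)

end LagrangeProjector

/-! The norm of `P_S` is the maximum over the cube of the Lebesgue function `∑ j, |λⱼ|`.

Lower bound: average the Lebesgue function over the `2 ^ n` vertices. At a random vertex an affine
function is its value at the centre plus a Rademacher sum, so a Khinchin inequality bounds its mean
absolute value below by `√(s / 3)`, with `s` the sum of squares of its centred coefficients. Since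
`λⱼ` equals 1 at a node in the cube, Cauchy-Schwarz gives `s ≥ 1 / (n + 1)`. Summing over the `n +
1` functions yields `√((n + 1) / 3) ≤ ‖P_S‖`, which exceeds `√n / 2` and hence both claimed bounds.

Attainment: minimise over nodes together with their dual affine functions and a bound for the
Lebesgue function. The duality relations are closed and force nondegeneracy, so no limit of
admissible simplices collapses. -/

namespace LagrangeProjector

/-! ### Affine functions in coordinates -/

/-- The affine function `x ↦ c.1 + ∑ i, c.2 i * x i`. -/
noncomputable def affineOfCoeffs {n : ℕ} (c : ℝ × (Fin n → ℝ)) : (Fin n → ℝ) →ᵃ[ℝ] ℝ :=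
  (∑ i, c.2 i • LinearMap.proj (R := ℝ) (φ := fun _ : Fin n => ℝ) i).toAffineMap
    + AffineMap.const ℝ (Fin n → ℝ) c.1

theorem affineOfCoeffs_apply {n : ℕ} (c : ℝ × (Fin n → ℝ)) (x : Fin n → ℝ) :
    affineOfCoeffs c x = c.1 + ∑ i, c.2 i * x i := by
  simp [affineOfCoeffs, add_comm]

/-- The coefficients of an affine function. -/
noncomputable def coeffs {n : ℕ} (p : (Fin n → ℝ) →ᵃ[ℝ] ℝ) : ℝ × (Fin n → ℝ) :=
  (p 0, fun i => p (Pi.single i 1) - p 0)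

theorem affineOfCoeffs_coeffs {n : ℕ} (p : (Fin n → ℝ) →ᵃ[ℝ] ℝ) :
    affineOfCoeffs (coeffs p) = p := by
  have hlin : ∀ v, p v = p.linear v + p 0 := fun v => by
    have := p.map_vadd 0 v
    simpa using this
  ext x
  rw [affineOfCoeffs_apply, hlin x]
  have hx : p.linear x = ∑ i, x i * p.linear (Pi.single i 1) := by
    conv_lhs => rw [pi_eq_sum_univ' x]
    simp only [map_sum, map_smul, smul_eq_mul]
  rw [hx, add_comm]
  congr 1
  refine Finset.sum_congr rfl fun i _ => ?_
  simp only [coeffs]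
  rw [hlin (Pi.single i 1)]
  ring

/-! ### The norm of the projector -/

theorem sum_abs_lagrangePoly_le_norm {n : ℕ} {K : Set (Fin n → ℝ)} [CompactSpace K]
    (S : Affine.Simplex ℝ (Fin n → ℝ) n) (hS : ∀ j, S.points j ∈ K) {x : Fin n → ℝ}
    (hx : x ∈ K) : ∑ j, |lagrangePoly S j x| ≤ ‖projector S hS‖ := by
  set s : Fin (n + 1) → ℝ := fun j => SignType.sign (lagrangePoly S j x) with hs
  have hs1 : ∀ j, -1 ≤ s j ∧ s j ≤ 1 := fun j => by
    rcases lt_trichotomy (lagrangePoly S j x) 0 with h | h | h <;> simp [hs, h]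
  -- Clipping to `[-1, 1]` gives norm at most 1 and does not change the values `s k` at the nodes.
  let f : C(K, ℝ) := ⟨fun y => max (-1) (min 1 (∑ j, s j * lagrangePoly S j y)), by
    refine continuous_const.max (continuous_const.min (continuous_finsetSum _ fun j _ => ?_))
    exact continuous_const.mul ((lagrangePoly S j).continuous_of_finiteDimensional.comp
      continuous_subtype_val)⟩
  have hf : ‖f‖ ≤ 1 := by
    refine (ContinuousMap.norm_le _ zero_le_one).2 fun y => ?_
    rw [Real.norm_eq_abs, abs_le]
    exact ⟨le_max_left _ _, max_le (by norm_num) (min_le_left _ _)⟩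
  have hfk : ∀ k, f ⟨S.points k, hS k⟩ = s k := fun k => by
    simp [f, lagrangePoly_points, hs1 k]
  calc ∑ j, |lagrangePoly S j x| = projector S hS f ⟨x, hx⟩ := by
        simp [projector_apply, interp_apply, hfk, hs, sign_mul_self]
    _ ≤ ‖projector S hS f‖ := (le_abs_self _).trans ((projector S hS f).norm_coe_le_norm _)
    _ ≤ ‖projector S hS‖ * ‖f‖ := (projector S hS).le_opNorm f
    _ ≤ ‖projector S hS‖ := mul_le_of_le_one_right (projector S hS).opNorm_nonneg hf

theorem norm_projector_le {n : ℕ} {K : Set (Fin n → ℝ)} [CompactSpace K]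
    (S : Affine.Simplex ℝ (Fin n → ℝ) n) (hS : ∀ j, S.points j ∈ K) {M : ℝ} (hM : 0 ≤ M)
    (h : ∀ x ∈ K, ∑ j, |lagrangePoly S j x| ≤ M) : ‖projector S hS‖ ≤ M := by
  refine ContinuousLinearMap.opNorm_le_bound _ hM fun f => ?_
  refine (ContinuousMap.norm_le _ (by positivity)).2 fun x => ?_
  rw [projector_apply, interp_apply]
  calc ‖∑ j, f ⟨S.points j, hS j⟩ * lagrangePoly S j x‖
      ≤ ∑ j, ‖f‖ * |lagrangePoly S j x| := by
        refine norm_sum_le_of_le _ fun j _ => ?_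
        rw [norm_mul, Real.norm_eq_abs (lagrangePoly S j x)]
        gcongr
        exact f.norm_coe_le_norm _
    _ = (∑ j, |lagrangePoly S j x|) * ‖f‖ := by rw [← Finset.mul_sum, mul_comm]
    _ ≤ M * ‖f‖ := by gcongr; exact h x x.2

/-! ### Attainment of the minimum -/

/-- Applying `p k` to a vanishing affine combination isolates the weight of `x k`. Independence, an
open condition, thus follows from closed equations. -/
theorem affineIndependent_of_dual {n : ℕ} {x : Fin (n + 1) → Fin n → ℝ}
    {p : Fin (n + 1) → (Fin n → ℝ) →ᵃ[ℝ] ℝ} (h : ∀ j k, p j (x k) = if j = k then 1 else 0) :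
    AffineIndependent ℝ x := by
  rw [affineIndependent_iff]
  intro s w hw hx k hk
  have h1 : ∑ i ∈ s, w i * p k (x i) = 0 := by
    have : ∀ v, p k v = (p k).linear v + p k 0 := fun v => by simpa using (p k).map_vadd 0 v
    have hlin : ∑ i ∈ s, w i * (p k).linear (x i) = 0 := by
      have := congrArg (p k).linear hx
      rwa [map_sum, map_zero, Finset.sum_congr rfl fun i _ => map_smul (p k).linear (w i) (x i)]
        at this
    rw [Finset.sum_congr rfl fun i _ => by rw [this (x i), mul_add], Finset.sum_add_distrib, hlin,
      ← Finset.sum_mul, hw, zero_mul, add_zero]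
  simpa [h, hk] using h1

theorem exists_simplex_of_dual {n : ℕ} {x : Fin (n + 1) → Fin n → ℝ}
    {p : Fin (n + 1) → (Fin n → ℝ) →ᵃ[ℝ] ℝ} (h : ∀ j k, p j (x k) = if j = k then 1 else 0) :
    ∃ S : Affine.Simplex ℝ (Fin n → ℝ) n, S.points = x ∧ ∀ j, lagrangePoly S j = p j := by
  refine ⟨⟨x, affineIndependent_of_dual h⟩, rfl, fun j => ?_⟩
  refine AffineMap.ext_on (s := Set.range x)
    (vertexBasis ⟨x, affineIndependent_of_dual h⟩).tot ?_
  rintro _ ⟨k, rfl⟩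
  rw [h]
  exact lagrangePoly_points _ j k

theorem single_one_mem_unitCube {n : ℕ} (i : Fin n) : Pi.single i (1 : ℝ) ∈ unitCube n := by
  constructor <;> intro k <;> by_cases hk : k = i <;> simp [hk]

theorem zero_mem_unitCube (n : ℕ) : (0 : Fin n → ℝ) ∈ unitCube n := by
  simp [unitCube]

theorem projectorNorms_unitCube_nonempty (n : ℕ) : (projectorNorms (unitCube n)).Nonempty := by
  let x : Fin (n + 1) → Fin n → ℝ := Fin.cons 0 fun i => Pi.single i 1
  let p : Fin (n + 1) → (Fin n → ℝ) →ᵃ[ℝ] ℝ :=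
    Fin.cons (affineOfCoeffs (1, fun _ => -1)) fun i => affineOfCoeffs (0, Pi.single i 1)
  have h : ∀ j k, p j (x k) = if j = k then 1 else 0 := by
    intro j k
    refine Fin.cases ?_ (fun j => ?_) j <;> refine Fin.cases ?_ (fun k => ?_) k <;>
      simp [p, x, affineOfCoeffs_apply, Pi.single_apply, Fin.succ_ne_zero, eq_comm]
  obtain ⟨S, hSx, -⟩ := exists_simplex_of_dual h
  refine ⟨_, S, fun j => ?_, rfl⟩
  rw [hSx]
  refine Fin.cases ?_ (fun j => ?_) j
  · exact zero_mem_unitCube n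
  · exact single_one_mem_unitCube j

/-- Nodes in the cube, coefficients of the dual affine functions, and a bound `M ≤ B` for the
Lebesgue function. -/
def admissible (n : ℕ) (B : ℝ) :
    Set ((Fin (n + 1) → Fin n → ℝ) × (Fin (n + 1) → ℝ × (Fin n → ℝ)) × ℝ) :=
  {t | (∀ j, t.1 j ∈ unitCube n) ∧
    (∀ j k, affineOfCoeffs (t.2.1 j) (t.1 k) = if j = k then 1 else 0) ∧
    (∀ x ∈ unitCube n, ∑ j, |affineOfCoeffs (t.2.1 j) x| ≤ t.2.2) ∧ t.2.2 ≤ B}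

theorem nonneg_of_mem_admissible {n : ℕ} {B : ℝ}
    {t : (Fin (n + 1) → Fin n → ℝ) × (Fin (n + 1) → ℝ × (Fin n → ℝ)) × ℝ}
    (ht : t ∈ admissible n B) : 0 ≤ t.2.2 :=
  (Finset.sum_nonneg fun _ _ => abs_nonneg _).trans (ht.2.2.1 0 (zero_mem_unitCube n))

/-- Every condition is closed. The coefficients are bounded because they are `p 0` and the
differences `p eᵢ - p 0` of values at points of the cube, whence the radius `2 * B`. -/
theorem isCompact_admissible (n : ℕ) (B : ℝ) : IsCompact (admissible n B) := by
  refine Metric.isCompact_of_isClosed_isBounded ?_ ?_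
  · simp only [admissible, affineOfCoeffs_apply, Set.ofPred_and, Set.ofPred_forall]
    refine IsClosed.inter ?_ (IsClosed.inter ?_ (IsClosed.inter ?_ ?_))
    · exact isClosed_iInter fun j => isClosed_Icc.preimage (by fun_prop)
    · exact isClosed_iInter fun j => isClosed_iInter fun k =>
        isClosed_eq (by fun_prop) (by fun_prop)
    · exact isClosed_iInter fun x => isClosed_iInter fun _ =>
        isClosed_le (by fun_prop) (by fun_prop)
    · exact isClosed_le (by fun_prop) (by fun_prop)
  · refine (Bornology.IsBounded.prod (Metric.isBounded_Icc (0 : Fin (n + 1) → Fin n → ℝ) 1)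
      (Bornology.IsBounded.prod (Metric.isBounded_closedBall (x := 0) (r := 2 * B))
        (Metric.isBounded_Icc (0 : ℝ) B))).subset ?_
    intro t ht
    have hB : 0 ≤ B := (nonneg_of_mem_admissible ht).trans ht.2.2.2
    have hval : ∀ j, ∀ x ∈ unitCube n, |affineOfCoeffs (t.2.1 j) x| ≤ B := fun j x hx =>
      (Finset.single_le_sum (f := fun j => |affineOfCoeffs (t.2.1 j) x|)
        (fun _ _ => abs_nonneg _) (Finset.mem_univ j)).trans ((ht.2.2.1 x hx).trans ht.2.2.2)
    refine ⟨⟨fun j => (ht.1 j).1, fun j => (ht.1 j).2⟩, ?_, nonneg_of_mem_admissible ht, ht.2.2.2⟩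
    rw [mem_closedBall_zero_iff, pi_norm_le_iff_of_nonneg (by positivity)]
    intro j
    have h0 : |(t.2.1 j).1| ≤ B := by
      simpa [affineOfCoeffs_apply] using hval j 0 (zero_mem_unitCube n)
    refine norm_prod_le_iff.2 ⟨h0.trans (by linarith), ?_⟩
    rw [pi_norm_le_iff_of_nonneg (by positivity)]
    intro i
    have hi : |(t.2.1 j).1 + (t.2.1 j).2 i| ≤ B := by
      simpa [affineOfCoeffs_apply, Pi.single_apply] using hval j _ (single_one_mem_unitCube i)
    rw [abs_le] at h0 hi
    rw [Real.norm_eq_abs, abs_le]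
    constructor <;> linarith

theorem isLeast_theta_unitCube (n : ℕ) :
    IsLeast (projectorNorms (unitCube n)) (theta (unitCube n)) := by
  have hbdd : BddBelow (projectorNorms (unitCube n)) :=
    ⟨0, by rintro _ ⟨S, hS, rfl⟩; exact (projector S hS).opNorm_nonneg⟩
  have hmem : ∀ (S : Affine.Simplex ℝ (Fin n → ℝ) n) (hS : ∀ j, S.points j ∈ unitCube n) (B : ℝ),
      ‖projector S hS‖ ≤ B →
      (S.points, fun j => coeffs (lagrangePoly S j), ‖projector S hS‖) ∈ admissible n B := by
    intro S hS B hB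
    refine ⟨hS, fun j k => ?_, fun x hx => ?_, hB⟩
    · rw [affineOfCoeffs_coeffs, lagrangePoly_points]
    · simp_rw [affineOfCoeffs_coeffs]
      exact sum_abs_lagrangePoly_le_norm S hS hx
  obtain ⟨_, S₀, hS₀, rfl⟩ := projectorNorms_unitCube_nonempty n
  obtain ⟨t, ht, htmin⟩ := (isCompact_admissible n ‖projector S₀ hS₀‖).exists_isMinOn
    ⟨_, hmem S₀ hS₀ _ le_rfl⟩ (f := fun t => t.2.2) (by fun_prop)
  obtain ⟨S, hSx, hSp⟩ := exists_simplex_of_dual ht.2.1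
  have hS : ∀ j, S.points j ∈ unitCube n := fun j => by rw [hSx]; exact ht.1 j
  have hle : ‖projector S hS‖ ≤ t.2.2 :=
    norm_projector_le S hS (nonneg_of_mem_admissible ht) fun x hx => by
      simpa only [hSp] using ht.2.2.1 x hx
  have hleast : IsLeast (projectorNorms (unitCube n)) ‖projector S hS‖ := by
    refine ⟨⟨S, hS, rfl⟩, ?_⟩
    rintro _ ⟨T, hT, rfl⟩
    -- Compactness covers only norms up to that of the reference simplex `S₀`; larger norms cannot
    -- beat the minimum.
    rcases le_total ‖projector T hT‖ ‖projector S₀ hS₀‖ with h | h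
    · exact hle.trans (isMinOn_iff.1 htmin _ (hmem T hT _ h))
    · exact (hle.trans ht.2.2.2).trans h
  have : theta (unitCube n) = ‖projector S hS‖ := hleast.csInf_eq
  rwa [this]

/-! ### Moments of Rademacher sums -/

/-- The sign `±1` encoded by a Boolean. -/
def boolSign (b : Bool) : ℝ := if b then 1 else -1

theorem sum_rademacher_succ {n : ℕ} (g : ℝ → ℝ) (a : ℝ) (b : Fin (n + 1) → ℝ) :
    ∑ ε : Fin (n + 1) → Bool, g (a + ∑ i, b i * boolSign (ε i)) =
      ∑ ε : Fin n → Bool, (g (a + ∑ i : Fin n, b i.succ * boolSign (ε i) + b 0) +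
        g (a + ∑ i : Fin n, b i.succ * boolSign (ε i) - b 0)) := by
  rw [← (Fin.consEquiv fun _ => Bool).sum_comp, Fintype.sum_prod_type_right]
  refine Finset.sum_congr rfl fun ε _ => ?_
  simp only [Fintype.sum_bool, Fin.consEquiv_apply, Fin.sum_univ_succ, Fin.cons_zero,
    Fin.cons_succ, boolSign]
  congr 2 <;> simp <;> ring

theorem sum_rademacher_sq {n : ℕ} (a : ℝ) (b : Fin n → ℝ) :
    ∑ ε : Fin n → Bool, (a + ∑ i, b i * boolSign (ε i)) ^ 2 = 2 ^ n * (a ^ 2 + ∑ i, b i ^ 2) := by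
  induction n with
  | zero => simp
  | succ n ih =>
    rw [sum_rademacher_succ (· ^ 2), Fin.sum_univ_succ]
    have h : ∀ y : ℝ, (y + b 0) ^ 2 + (y - b 0) ^ 2 = 2 * y ^ 2 + 2 * b 0 ^ 2 := fun y => by ring
    simp only [h, Finset.sum_add_distrib, ← Finset.mul_sum, ih]
    simp
    ring

/-- In the induction the cross terms in `b 0 ^ 2` match exactly on both sides; only a multiple of `b
0 ^ 4` is lost. -/
theorem sum_rademacher_pow_four_le {n : ℕ} (a : ℝ) (b : Fin n → ℝ) :
    ∑ ε : Fin n → Bool, (a + ∑ i, b i * boolSign (ε i)) ^ 4 ≤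
      2 ^ n * (3 * (a ^ 2 + ∑ i, b i ^ 2) ^ 2) := by
  induction n with
  | zero => simp; nlinarith [sq_nonneg (a ^ 2)]
  | succ n ih =>
    rw [sum_rademacher_succ (· ^ 4), Fin.sum_univ_succ]
    have h : ∀ y : ℝ, (y + b 0) ^ 4 + (y - b 0) ^ 4
        = 2 * y ^ 4 + 12 * b 0 ^ 2 * y ^ 2 + 2 * b 0 ^ 4 := fun y => by ring
    simp only [h, Finset.sum_add_distrib, ← Finset.mul_sum, sum_rademacher_sq]
    have := ih fun i => b i.succ
    have h4 : 0 ≤ (2 : ℝ) ^ n * b 0 ^ 4 := by positivity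
    have hconst : ∑ _ε : Fin n → Bool, b 0 ^ 4 = 2 ^ n * b 0 ^ 4 := by simp
    rw [hconst, pow_succ 2 n]
    linarith

/-- A Khinchin inequality. -/
theorem le_sum_rademacher_abs {n : ℕ} (a : ℝ) (b : Fin n → ℝ) :
    2 ^ n * √((a ^ 2 + ∑ i, b i ^ 2) / 3) ≤
      ∑ ε : Fin n → Bool, |a + ∑ i, b i * boolSign (ε i)| := by
  set s := a ^ 2 + ∑ i, b i ^ 2 with hs
  have hs0 : 0 ≤ s := by positivity
  rcases hs0.eq_or_lt with h | h
  · rw [← h]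
    simpa using Finset.sum_nonneg fun ε _ => abs_nonneg _
  set r := √(s / 3) with hr
  have hr0 : 0 < r := by positivity
  have hr2 : s = 3 * r ^ 2 := by rw [hr, Real.sq_sqrt (by positivity)]; ring
  -- Minorant of `|u|` by second and fourth powers, touching at `|u| = 3 * r`. With second moment `s
  -- = 3 * r ^ 2` and fourth moment at most `3 * s ^ 2`, the left side has mean at least `54 * r ^
  -- 4`.
  have hpt : ∀ u : ℝ, 27 * r ^ 2 * u ^ 2 - u ^ 4 ≤ 54 * r ^ 3 * |u| := fun u => by
    have h0 := abs_nonneg u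
    have : 0 ≤ |u| * (|u| - 3 * r) ^ 2 * (|u| + 6 * r) := by positivity
    rw [← sq_abs u, show u ^ 4 = |u| ^ 4 by rw [← abs_pow]; exact (abs_of_nonneg (by positivity)).symm]
    linarith
  have hsum := Finset.sum_le_sum fun (ε : Fin n → Bool) (_ : ε ∈ Finset.univ) =>
    hpt (a + ∑ i, b i * boolSign (ε i))
  rw [Finset.sum_sub_distrib, ← Finset.mul_sum, ← Finset.mul_sum, sum_rademacher_sq, ← hs] at hsum
  have h4 := sum_rademacher_pow_four_le a b
  rw [← hs] at h4
  rw [hr2] at h4 hsum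
  refine le_of_mul_le_mul_left ?_ (show 0 < 54 * r ^ 3 by positivity)
  linarith

/-! ### The lower bound -/

/-- The vertices of the unit cube. -/
noncomputable def cubeVertex {n : ℕ} (ε : Fin n → Bool) : Fin n → ℝ :=
  fun i => (1 + boolSign (ε i)) / 2

theorem cubeVertex_mem {n : ℕ} (ε : Fin n → Bool) : cubeVertex ε ∈ unitCube n := by
  constructor <;> intro i <;> cases h : ε i <;> simp [cubeVertex, boolSign, h]

/-- An affine function taking the value `1` in the cube is not small on average at the vertices. -/
theorem le_sum_abs_cubeVertex {n : ℕ} (p : (Fin n → ℝ) →ᵃ[ℝ] ℝ) {x : Fin n → ℝ}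
    (hx : x ∈ unitCube n) (hp : p x = 1) :
    2 ^ n * √(1 / (3 * (n + 1))) ≤ ∑ ε : Fin n → Bool, |p (cubeVertex ε)| := by
  set c := coeffs p
  -- Expansion about the centre of the cube, where `2 * y i - 1` is a sign at each vertex.
  have hc : ∀ y, p y = (c.1 + ∑ i, c.2 i / 2) + ∑ i, c.2 i / 2 * (2 * y i - 1) := fun y => by
    conv_lhs => rw [← affineOfCoeffs_coeffs p, affineOfCoeffs_apply]
    rw [add_assoc, ← Finset.sum_add_distrib]
    congr 1
    exact Finset.sum_congr rfl fun i _ => by ring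
  set A := c.1 + ∑ i, c.2 i / 2
  have hv : ∀ ε : Fin n → Bool, p (cubeVertex ε) = A + ∑ i, c.2 i / 2 * boolSign (ε i) :=
    fun ε => by
      rw [hc]
      congr 1
      exact Finset.sum_congr rfl fun i _ => by rw [cubeVertex]; ring
  simp_rw [hv]
  refine le_trans ?_ (le_sum_rademacher_abs A fun i => c.2 i / 2)
  gcongr 2 ^ n * √?_
  have hy : ∑ i, (2 * x i - 1) ^ 2 ≤ (n : ℝ) := by
    calc ∑ i, (2 * x i - 1) ^ 2 ≤ ∑ _i : Fin n, (1 : ℝ) := Finset.sum_le_sum fun i _ => by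
          have h0 : 0 ≤ x i := hx.1 i
          have h1 : x i ≤ 1 := hx.2 i
          nlinarith
      _ = n := by simp
  -- The constant term is paired with an extra coordinate 1, so the second vector has squared length
  -- at most `n + 1`.
  have hcs := Finset.sum_mul_sq_le_sq_mul_sq Finset.univ
    (Fin.cons A (fun i => c.2 i / 2) : Fin (n + 1) → ℝ) (Fin.cons 1 fun i => 2 * x i - 1)
  simp only [Fin.sum_univ_succ, Fin.cons_zero, Fin.cons_succ, mul_one] at hcs
  rw [← hc, hp] at hcs
  have hs0 : 0 ≤ A ^ 2 + ∑ i, (c.2 i / 2) ^ 2 := by positivity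
  rw [div_le_div_iff₀ (by positivity) (by positivity)]
  nlinarith

theorem sqrt_le_norm_projector {n : ℕ} (S : Affine.Simplex ℝ (Fin n → ℝ) n)
    (hS : ∀ j, S.points j ∈ unitCube n) : √((n + 1) / 3) ≤ ‖projector S hS‖ := by
  have h1 : ∑ ε : Fin n → Bool, ∑ j, |lagrangePoly S j (cubeVertex ε)|
      ≤ 2 ^ n * ‖projector S hS‖ := by
    refine (Finset.sum_le_sum fun ε _ =>
      sum_abs_lagrangePoly_le_norm S hS (cubeVertex_mem ε)).trans_eq ?_
    simp
  rw [Finset.sum_comm] at h1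
  have h2 : (n + 1) * (2 ^ n * √(1 / (3 * (n + 1)))) ≤
      ∑ j, ∑ ε : Fin n → Bool, |lagrangePoly S j (cubeVertex ε)| := by
    refine le_of_eq_of_le ?_ (Finset.sum_le_sum fun j _ => le_sum_abs_cubeVertex
      (lagrangePoly S j) (hS j) (by simp [lagrangePoly_points]))
    simp
  have h3 : √(((n : ℝ) + 1) / 3) = (n + 1) * √(1 / (3 * (n + 1))) := by
    rw [Real.sqrt_eq_iff_mul_self_eq (by positivity) (by positivity), mul_mul_mul_comm,
      Real.mul_self_sqrt (by positivity)]
    field_simp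
  rw [h3]
  refine le_of_mul_le_mul_left ?_ (show (0 : ℝ) < 2 ^ n by positivity)
  linarith

end LagrangeProjector

theorem mainTheorem4 (n : ℕ) (hn : 1 ≤ n) :
    IsLeast (LagrangeProjector.projectorNorms (LagrangeProjector.unitCube n))
        (LagrangeProjector.theta (LagrangeProjector.unitCube n)) ∧
      LagrangeProjector.theta (LagrangeProjector.unitCube n)
        > Real.sqrt ((n : ℝ) - 1) / Real.exp 1 ∧
      LagrangeProjector.theta (LagrangeProjector.unitCube n)
        > 2 * Real.sqrt 2 / (3 * Real.exp 1) * Real.sqrt (n : ℝ) := by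
  have hleast := LagrangeProjector.isLeast_theta_unitCube n
  obtain ⟨S, hS, hθ⟩ := hleast.1
  have hθ' : √(((n : ℝ) + 1) / 3) ≤ LagrangeProjector.theta (LagrangeProjector.unitCube n) :=
    hθ ▸ LagrangeProjector.sqrt_le_norm_projector S hS
  have he : 2 ≤ Real.exp 1 := by linarith [Real.add_one_le_exp 1]
  -- `√n / 2` dominates both targets: the first because `e ≥ 2`, the second because also `√2 ≤ 3 /
  -- 2`.
  have hhalf : √(n : ℝ) / 2 < √(((n : ℝ) + 1) / 3) := by
    refine Real.lt_sqrt_of_sq_lt ?_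
    rw [div_pow, Real.sq_sqrt (by positivity)]
    have : (0 : ℝ) ≤ n := by positivity
    linarith
  refine ⟨hleast, lt_of_le_of_lt ?_ (hhalf.trans_le hθ'), lt_of_le_of_lt ?_ (hhalf.trans_le hθ')⟩
  · gcongr
    linarith
  · have h2 : √2 ≤ 3 / 2 := Real.sqrt_le_iff.2 ⟨by norm_num, by norm_num⟩
    have h3 : 2 * √2 / (3 * Real.exp 1) ≤ 1 / 2 := by
      rw [div_le_div_iff₀ (by positivity) (by norm_num)]
      linarith
    rw [div_eq_mul_one_div √(n : ℝ), mul_comm √(n : ℝ)]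
    gcongr
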